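/- Let $\kappa$ be a regular uncountable cardinal. A family $I$ of subsets of $\kappa$ is called monotone if it is closed under subsets; a subset of $\kappa$ is $I$-positive if it does not belong to $I$. For a family $I$ and a limit ordinal $\gamma\le\kappa$, consider games of length $\gamma$ in which, in each round $\beta<\gamma$, the player Cut divides $\kappa$ into two disjoint pieces (one of which may be empty) and then the player Choose picks one of the two pieces. For $\delta\le\gamma$, let $D_\delta$ be the intersection of the first $\delta$ many choices of Choose (with $D_0=\kappa$). - In $\mathcal U(\kappa,I,\gamma)$, Choose wins if and only if $D_\gamma$ is $I$-positive. - In $\mathcal U(\kappa,I,{\le}\gamma)$, Choose wins if and only if $D_\delta$ is $I$-positive for all $\delta<\gamma$ and $D_\gamma\neq\emptyset$. - In $\mathcal U(\kappa,I,{<}\gamma)$, Choose wins if and only if $D_\delta$ is $I$-positive for all $\delta<\gamma$. Otherwise, Cut wins. We say that Cut wins a game if Cut has a winning strategy in it. Let $2^{<\gamma}=\sup\{2^\delta\mid\delta<\gamma\text{ is a cardinal}\}$, let $\mathrm{bd}_\kappa$ be the family of bounded subsets of $\kappa$, and call $\kappa$ weakly compact if $\kappa\to(\kappa)^2_2$.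 Let $\gamma<\kappa$ be a limit ordinal, and let $I$ be a monotone family of subsets of $\kappa$ such that $\kappa$ is not a union of fewer than $\kappa$ many elements of $I$. Then the following hold. 1. If Cut wins $\mathcal U(\kappa,I,\gamma)$, then $\kappa\le 2^{|\gamma|}$. If $I$ contains all singletons $\{\alpha\}$ with $\alpha<\kappa$, then Cut wins $\mathcal U(\kappa,I,\gamma)$ if and only if $\kappa\le 2^{|\gamma|}$. 2. If Cut wins $\mathcal U(\kappa,I,{\le}\gamma)$, then $\kappa\le 2^{<\gamma}$. If $I$ contains all singletons $\{\alpha\}$ with $\alpha<\kappa$, then Cut wins $\mathcal U(\kappa,I,{\le}\gamma)$ if and only if $\kappa\le 2^{<\gamma}$. 3. If $\kappa>2^{<\gamma}$, then Cut does not win $\mathcal U(\kappa,I,{<}\gamma)$. Moreover: 4. Cut wins $\mathcal U(\kappa,\mathrm{bd}_\kappa,{<}\kappa)$ if and only if $\kappa$ is not weakly compact. -/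

import Mathlib

universe u

namespace CutChoose

/-- A move of the player Cut: a division of `X` into two disjoint (possibly empty) pieces. -/
structure Cut {α : Type u} (X : Set α) where
  piece : Bool → Set α
  disjoint : Disjoint (piece false) (piece true)
  union : piece false ∪ piece true = X

/-- One round of the game: Cut divides `X`, and Choose picks one of the two pieces. -/
structure Round {α : Type u} (X : Set α) where
  cut : Cut X
  choice : Bool

/-- The piece that was picked by Choose in the given round. -/
def Round.picked {α : Type u} {X : Set α} (m : Round X) : Set α :=
  m.cut.piece m.choice

/-- A play of length `γ`: one round for every ordinal below `γ`. -/
abbrev Play {α : Type u} (X : Set α) (γ : Ordinal.{u}) :=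
  Set.Iio γ → Round X

/-- The first `δ`-many rounds of a play. -/
def Play.upTo {α : Type u} {X : Set α} {γ : Ordinal.{u}} (p : Play X γ) (δ : Set.Iio γ) :
    Play X (δ : Ordinal.{u}) :=
  fun β => p ⟨β.1, lt_trans (Set.mem_Iio.1 β.2) (Set.mem_Iio.1 δ.2)⟩

/-- The intersection of all choices in a play (it is `X` if there are no rounds). -/
def Play.result {α : Type u} {X : Set α} {γ : Ordinal.{u}} (p : Play X γ) : Set α :=
  {x ∈ X | ∀ β : Set.Iio γ, x ∈ (p β).picked}

/-- A strategy for Cut in a game of length `γ`: it answers every sequence of `δ < γ` many rounds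
with a division of `X`. -/
abbrev CutStrategy {α : Type u} (X : Set α) (γ : Ordinal.{u}) :=
  (δ : Set.Iio γ) → Play X (δ : Ordinal.{u}) → Cut X

/-- Cut has followed the strategy `σ` throughout the play `p`. -/
def Play.Follows {α : Type u} {X : Set α} {γ : Ordinal.{u}} (p : Play X γ)
    (σ : CutStrategy X γ) : Prop :=
  ∀ δ : Set.Iio γ, (p δ).cut = σ δ (p.upTo δ)

/-- Cut has a winning strategy in the game of length `γ` on `X` in which Choose wins exactly
the plays that satisfy `ChooseWins`. -/
def CutHasWinningStrategy {α : Type u} (X : Set α) (γ : Ordinal.{u})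
    (ChooseWins : Play X γ → Prop) : Prop :=
  ∃ σ : CutStrategy X γ, ∀ p : Play X γ, p.Follows σ → ¬ ChooseWins p

/-- Cut wins `𝒰(X, I, γ)`: Choose needs the final intersection to be `I`-positive. -/
def CutWins {α : Type u} (X : Set α) (I : Set (Set α)) (γ : Ordinal.{u}) : Prop :=
  CutHasWinningStrategy X γ fun p => p.result ∉ I

/-- Cut wins `𝒰(X, I, ≤γ)`: Choose needs the intersection of choices to be `I`-positive at all
stages `δ < γ`, and nonempty at the final stage `γ`. -/
def CutWinsLE {α : Type u} (X : Set α) (I : Set (Set α)) (γ : Ordinal.{u}) : Prop :=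
  CutHasWinningStrategy X γ fun p =>
    (∀ δ : Set.Iio γ, (p.upTo δ).result ∉ I) ∧ p.result.Nonempty

/-- Cut wins `𝒰(X, I, <γ)`: Choose needs the intersection of choices to be `I`-positive at all
stages `δ < γ`. -/
def CutWinsLT {α : Type u} (X : Set α) (I : Set (Set α)) (γ : Ordinal.{u}) : Prop :=
  CutHasWinningStrategy X γ fun p => ∀ δ : Set.Iio γ, (p.upTo δ).result ∉ I

/-- A family of sets that is closed under subsets. -/
def IsMonotoneFamily {α : Type u} (I : Set (Set α)) : Prop :=
  ∀ A ∈ I, ∀ B ⊆ A, B ∈ I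

/-- The set `α` is not the union of fewer than `κ` members of `I`. -/
def NotSmallUnion {α : Type u} (κ : Cardinal.{u}) (I : Set (Set α)) : Prop :=
  ∀ 𝒜 : Set (Set α), 𝒜 ⊆ I → Cardinal.mk 𝒜 < κ → ⋃₀ 𝒜 ≠ Set.univ

/-- The family of bounded subsets of `κ`. -/
def bd (κ : Cardinal.{u}) : Set (Set κ.ord.ToType) :=
  {A | BddAbove A}

/-- `2 ^ {<γ}` for an ordinal `γ`: the supremum of `2 ^ δ` over all cardinals `δ < γ`. -/
noncomputable def twoPowLT (γ : Ordinal.{u}) : Cardinal.{u} :=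
  sSup ((fun δ : Cardinal.{u} => 2 ^ δ) '' {δ | δ.ord < γ})

/-- The supremum in `twoPowLT` is a genuine one. -/
theorem isLUB_twoPowLT {γ : Ordinal.{u}} (hγ : 0 < γ) :
    IsLUB ((fun δ : Cardinal.{u} => (2 : Cardinal.{u}) ^ δ) '' {δ | δ.ord < γ}) (twoPowLT γ) := by
  refine isLUB_csSup ⟨_, 0, by simpa using hγ, rfl⟩ ⟨2 ^ γ.card, ?_⟩
  rintro _ ⟨δ, hδ, rfl⟩
  exact Cardinal.power_le_power_left two_ne_zero
    (by simpa using Ordinal.card_le_card (le_of_lt (show δ.ord < γ from hδ)))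

/-- `κ` is weakly compact: it is uncountable and `κ → (κ)²₂`, that is, every colouring of the
two-element subsets of `κ` in two colours has a homogeneous set of size `κ`. -/
def IsWeaklyCompact (κ : Cardinal.{u}) : Prop :=
  Cardinal.aleph0 < κ ∧
    ∀ f : κ.ord.ToType → κ.ord.ToType → Bool,
      ∃ (H : Set κ.ord.ToType) (b : Bool), Cardinal.mk H = κ ∧
        ∀ x ∈ H, ∀ y ∈ H, x < y → f x y = b

end CutChoose

/-!
A play that follows a given strategy of Cut is determined by the choices of Choose
(`CutChoose.Play.Follows.ext`), so the plays of length `γ` that follow it have at most `2 ^ |γ|`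
results (`CutChoose.mk_outcomes_le`); and for each point `x`, Choose may always pick the piece that
contains `x` (`CutChoose.exists_follows_mem`), so these results cover the board. Hence, if Cut wins
`𝒰(κ, I, γ)`, then `κ` is a union of `2 ^ |γ|` members of `I`. If Cut wins `𝒰(κ, I, ≤γ)`, the same
count is applied to each of the strategies restricted to the lengths `δ < γ`, giving
`|γ| * 2 ^ {<γ}` members of `I`. Conversely, if `κ ≤ 2 ^ |γ|`, then Cut identifies points of `κ`
with functions from `γ` to `Bool` and splits according to the successive coordinates, which leaves
at most one point. If `κ ≤ 2 ^ {<γ}`, then already `κ ≤ 2 ^ |δ|` for some `δ < γ`, because `κ` is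
regular and `γ < κ`.

For the last equivalence, suppose first that a colouring `f` has no homogeneous set of size `κ`. At
stage `a`, Cut splits `κ` according to the value of `f a`. If Choose survived all stages, with
`v a` as the choice at stage `a`, then a maximal set `S` such that `f x y = v x` for all `x < y` in
`S` would be unbounded, and so would be the part of `S` on which `v` takes one of the two values:
this part is homogeneous. Suppose now that `κ` is weakly compact, and fix a strategy of Cut. For
each `x` consider the play in which Choose always picks the piece containing `x`, and colour
`x < y` by the choice made in the play of `x` at the first stage at which the plays of `x` and `y`
differ. On a homogeneous set `H`, by induction on `δ`, the choices at stage `δ` are eventually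
constant; playing these eventual values wins for Choose, as each partial result contains a final
segment of `H`.
-/

open Cardinal Set

namespace CutChoose

variable {α : Type u} {X : Set α} {γ : Ordinal.{u}}

/-! ### Plays and strategies -/

/-- A round before stage `δ < γ`, as a round of the game of length `γ`. -/
abbrev below (δ : Iio γ) (β : Iio (δ : Ordinal.{u})) : Iio γ :=
  ⟨β.1, lt_trans (mem_Iio.1 β.2) (mem_Iio.1 δ.2)⟩

theorem below_lt (δ : Iio γ) (β : Iio (δ : Ordinal.{u})) : below δ β < δ := β.2

/-- A play that follows a strategy is determined by the choices of Choose, round by round. -/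
theorem Play.Follows.ext {σ : CutStrategy X γ} {p q : Play X γ} (hp : p.Follows σ)
    (hq : q.Follows σ) (δ : Iio γ) (h : ∀ β ≤ δ, (p β).choice = (q β).choice) : p δ = q δ := by
  induction δ using WellFoundedLT.induction with
  | ind δ ih =>
    have hup : p.upTo δ = q.upTo δ := by
      funext β
      have hβ := below_lt δ β
      exact ih _ hβ fun ξ hξ => h ξ (hξ.trans hβ.le)
    have hcut : (p δ).cut = (q δ).cut := by rw [hp δ, hq δ, hup]
    have hch := h δ le_rfl
    revert hcut hch
    rcases p δ with ⟨c, b⟩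
    rcases q δ with ⟨c', b'⟩
    rintro rfl rfl
    rfl

/-- The play in which Cut follows `σ` and Choose follows the rule `c`, which may depend on the
earlier rounds. -/
def playAgainst (σ : CutStrategy X γ) (c : (δ : Iio γ) → Play X (δ : Ordinal.{u}) → Bool) :
    (δ : Iio γ) → Round X
  | δ =>
    let q : Play X (δ : Ordinal.{u}) := fun β => playAgainst σ c (below δ β)
    ⟨σ δ q, c δ q⟩
termination_by δ => (δ : Ordinal.{u})
decreasing_by exact mem_Iio.1 β.2

theorem playAgainst_apply (σ : CutStrategy X γ)
    (c : (δ : Iio γ) → Play X (δ : Ordinal.{u}) → Bool) (δ : Iio γ) :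
    playAgainst σ c δ = ⟨σ δ (Play.upTo (playAgainst σ c) δ),
      c δ (Play.upTo (playAgainst σ c) δ)⟩ := by
  rw [playAgainst]
  rfl

theorem follows_playAgainst (σ : CutStrategy X γ)
    (c : (δ : Iio γ) → Play X (δ : Ordinal.{u}) → Bool) :
    Play.Follows (playAgainst σ c) σ := fun δ => by
  rw [playAgainst_apply]

open Classical in
/-- Against any strategy of Cut, Choose can keep a given point of the board. -/
theorem exists_follows_mem (σ : CutStrategy X γ) {x : α} (hx : x ∈ X) :
    ∃ p : Play X γ, p.Follows σ ∧ ∀ δ, x ∈ (p δ).picked := by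
  refine ⟨playAgainst σ fun δ q => decide (x ∈ (σ δ q).piece true), follows_playAgainst _ _, ?_⟩
  intro δ
  rw [playAgainst_apply, Round.picked]
  generalize σ δ (Play.upTo _ δ) = C
  have hC : x ∈ C.piece false ∪ C.piece true := C.union.symm ▸ hx
  by_cases h : x ∈ C.piece true
  · simp [h]
  · simpa [h] using hC

/-- The strategy `σ`, used in the game of length `δ < γ`. -/
def CutStrategy.restrict (σ : CutStrategy X γ) (δ : Iio γ) : CutStrategy X (δ : Ordinal.{u}) :=
  fun β q => σ (below δ β) q

theorem Play.Follows.upTo {σ : CutStrategy X γ} {p : Play X γ} (hp : p.Follows σ) (δ : Iio γ) :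
    (p.upTo δ).Follows (CutStrategy.restrict σ δ) :=
  fun β => hp (below δ β)

/-- The results of the plays in which Cut follows `σ`. -/
def outcomes (σ : CutStrategy X γ) : Set (Set α) :=
  {A | ∃ p : Play X γ, p.Follows σ ∧ p.result = A}

theorem mk_outcomes_le (σ : CutStrategy X γ) : #(outcomes σ) ≤ 2 ^ γ.card := by
  choose p hp hres using fun A : outcomes σ => A.2
  have hinj : Function.Injective fun (A : outcomes σ) (t : γ.ToType) =>
      (p A (Ordinal.ToType.mk.symm t)).choice := by
    intro A B hAB
    have : p A = p B := funext fun δ => (hp A).ext (hp B) δ fun β _ => by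
      simpa using congrFun hAB (Ordinal.ToType.mk β)
    exact Subtype.ext (by rw [← hres A, ← hres B, this])
  refine (mk_le_of_injective hinj).trans_eq ?_
  simp

theorem CutWinsLT.cutWinsLE {I : Set (Set α)} (h : CutWinsLT X I γ) : CutWinsLE X I γ := by
  obtain ⟨σ, hσ⟩ := h
  exact ⟨σ, fun p hp hwin => hσ p hp hwin.1⟩

/-! ### Bounds for the length of games that Cut wins -/

theorem CutWins.le_two_power {κ : Cardinal.{u}} {I : Set (Set α)} (hI : NotSmallUnion κ I)
    (h : CutWins univ I γ) : κ ≤ 2 ^ γ.card := by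
  obtain ⟨σ, hσ⟩ := h
  by_contra! hlt
  refine hI (outcomes σ) ?_ ((mk_outcomes_le σ).trans_lt hlt) ?_
  · rintro _ ⟨p, hp, rfl⟩
    exact not_not.1 (hσ p hp)
  · refine eq_univ_of_forall fun x => ?_
    obtain ⟨p, hp, hx⟩ := exists_follows_mem σ (mem_univ x)
    exact ⟨_, ⟨p, hp, rfl⟩, mem_univ x, hx⟩

theorem two_power_card_le_twoPowLT {δ : Ordinal.{u}} (h : δ < γ) : 2 ^ δ.card ≤ twoPowLT γ :=
  (isLUB_twoPowLT (pos_of_gt h)).1 ⟨δ.card, (ord_card_le δ).trans_lt h, rfl⟩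

theorem CutWinsLE.le_twoPowLT {κ : Cardinal.{u}} (hκ : ℵ₀ ≤ κ) (hγ : γ < κ.ord) {I : Set (Set α)}
    (hI : NotSmallUnion κ I) (h : CutWinsLE univ I γ) : κ ≤ twoPowLT γ := by
  obtain ⟨σ, hσ⟩ := h
  by_contra! hlt
  let 𝒜 : Set (Set α) := ⋃ t : γ.ToType,
    outcomes (CutStrategy.restrict σ (Ordinal.ToType.mk.symm t))
  have h𝒜 : #𝒜 < κ := by
    refine (mk_iUnion_le_sum_mk.trans (sum_le_sum _ (fun _ => twoPowLT γ) fun t =>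
      (mk_outcomes_le _).trans (two_power_card_le_twoPowLT (Ordinal.ToType.mk.symm t).2))).trans_lt
        ?_
    rw [sum_const']
    exact mul_lt_of_lt hκ (by simpa using lt_ord.1 hγ) hlt
  refine hI (𝒜 ∩ I) inter_subset_right ((mk_le_mk_of_subset inter_subset_left).trans_lt h𝒜) ?_
  refine eq_univ_of_forall fun x => ?_
  obtain ⟨p, hp, hx⟩ := exists_follows_mem σ (mem_univ x)
  obtain ⟨δ, hδ⟩ : ∃ δ : Iio γ, (p.upTo δ).result ∈ I := by
    by_contra! hpos
    exact hσ p hp ⟨hpos, x, mem_univ x, hx⟩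
  refine ⟨_, ⟨mem_iUnion.2 ⟨Ordinal.ToType.mk δ, ?_⟩, hδ⟩, mem_univ x, fun β => hx _⟩
  rw [OrderIso.symm_apply_apply]
  exact ⟨_, hp.upTo δ, rfl⟩

/-! ### Splitting by coordinates -/

/-- The division of the board according to the value of `s`. -/
def Cut.ofBool (X : Set α) (s : α → Bool) : Cut X where
  piece b := {x ∈ X | s x = b}
  disjoint := disjoint_left.2 fun x hx hx' => by simp_all
  union := by
    ext x
    cases h : s x <;> simp [h]

/-- The strategy that splits according to `s δ` at stage `δ`, whatever the earlier rounds are. -/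
def splitStrategy (X : Set α) (s : Iio γ → α → Bool) : CutStrategy X γ :=
  fun δ _ => Cut.ofBool X (s δ)

theorem Play.Follows.mem_picked_split {s : Iio γ → α → Bool} {p : Play X γ}
    (hp : p.Follows (splitStrategy X s)) {δ : Iio γ} {x : α} :
    x ∈ (p δ).picked ↔ x ∈ X ∧ s δ x = (p δ).choice := by
  rw [Round.picked, hp δ]
  rfl

theorem Play.Follows.subsingleton_result_split {s : Iio γ → α → Bool} {p : Play X γ}
    (hp : p.Follows (splitStrategy X s)) (hs : ∀ x y, (∀ δ, s δ x = s δ y) → x = y) :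
    p.result.Subsingleton := fun x hx y hy => hs x y fun δ => by
  rw [(hp.mem_picked_split.1 (hx.2 δ)).2, (hp.mem_picked_split.1 (hy.2 δ)).2]

theorem exists_separating {δ : Ordinal.{u}} (h : #α ≤ 2 ^ δ.card) :
    ∃ s : Iio δ → α → Bool, ∀ x y, (∀ β, s β x = s β y) → x = y := by
  have h' : #α ≤ #(δ.ToType → Bool) := by simpa using h
  obtain ⟨e⟩ := le_def _ _ |>.1 h'
  refine ⟨fun β x => e x (Ordinal.ToType.mk β), fun x y hxy => e.injective (funext fun t => ?_)⟩
  simpa using hxy (Ordinal.ToType.mk.symm t)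

theorem IsMonotoneFamily.mem_of_subsingleton [Nonempty α] {I : Set (Set α)}
    (hI : IsMonotoneFamily I) (hsing : ∀ x, {x} ∈ I) {A : Set α} (hA : A.Subsingleton) :
    A ∈ I := by
  obtain rfl | ⟨x, rfl⟩ := hA.eq_empty_or_singleton
  · exact hI _ (hsing (Classical.arbitrary α)) _ (empty_subset _)
  · exact hsing x

theorem cutWins_of_le_two_power [Nonempty α] {I : Set (Set α)} (hI : IsMonotoneFamily I)
    (hsing : ∀ x, {x} ∈ I) (h : #α ≤ 2 ^ γ.card) : CutWins X I γ := by
  obtain ⟨s, hs⟩ := exists_separating h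
  exact ⟨splitStrategy X s, fun p hp hwin =>
    hwin (hI.mem_of_subsingleton hsing (hp.subsingleton_result_split hs))⟩

theorem cutWinsLT_of_le_two_power [Nonempty α] {I : Set (Set α)} (hI : IsMonotoneFamily I)
    (hsing : ∀ x, {x} ∈ I) {δ : Ordinal.{u}} (hδ : δ < γ) (h : #α ≤ 2 ^ δ.card) :
    CutWinsLT X I γ := by
  obtain ⟨s, hs⟩ := exists_separating h
  -- Only the first `δ` many rounds matter; all later splits are trivial.
  let s' : Iio γ → α → Bool := fun β x => if hβ : β.1 < δ then s ⟨β.1, hβ⟩ x else false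
  refine ⟨splitStrategy X s', fun p hp hwin => hwin ⟨δ, hδ⟩
    (hI.mem_of_subsingleton hsing fun x hx y hy => hs x y fun β => ?_)⟩
  have hβ : (β.1 : Ordinal) < δ := β.2
  have key : ∀ z ∈ (p.upTo ⟨δ, hδ⟩).result, s β z = (p ⟨β.1, hβ.trans hδ⟩).choice := by
    intro z hz
    have := (hp.mem_picked_split.1 (hz.2 β)).2
    simpa only [s', dif_pos hβ] using this
  rw [key x hx, key y hy]

/-- For regular `κ` above `γ`, the supremum `2 ^ {<γ}` reaches `κ` only if one of its terms does. -/
theorem exists_le_two_power_of_le_twoPowLT {κ : Cardinal.{u}} (hreg : κ.IsRegular) (hγ : γ < κ.ord)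
    (h : κ ≤ twoPowLT γ) : ∃ δ < γ, κ ≤ 2 ^ δ.card := by
  by_contra! hlt
  have hsup : ⨆ t : γ.ToType, (2 : Cardinal.{u}) ^ (Ordinal.ToType.mk.symm t).1.card < κ :=
    iSup_lt_of_lt_cof_ord (by rw [hreg.cof_ord]; simpa using lt_ord.1 hγ)
      fun t => hlt _ (Ordinal.ToType.mk.symm t).2
  refine (h.trans ?_).not_gt hsup
  refine csSup_le' ?_
  rintro _ ⟨c, hc, rfl⟩
  refine le_of_eq_of_le ?_ (le_ciSup bddAbove_of_small (Ordinal.ToType.mk ⟨c.ord, hc⟩))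
  simp

/-! ### Bounded sets -/

theorem bddAbove_of_mk_lt {κ : Cardinal.{u}} (hreg : κ.IsRegular) {S : Set κ.ord.ToType}
    (h : #S < κ) : BddAbove S := by
  refine .of_not_isCofinal fun hS => (Order.cof_le hS).not_gt ?_
  rwa [Ordinal.cof_toType, hreg.cof_ord]

theorem mk_eq_iff_not_bddAbove {κ : Cardinal.{u}} (hreg : κ.IsRegular) {S : Set κ.ord.ToType} :
    #S = κ ↔ ¬ BddAbove S := by
  have := noMaxOrder hreg.aleph0_le
  constructor
  · rintro hS ⟨a, ha⟩
    obtain ⟨b, hb⟩ := exists_gt a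
    have hsub : S ⊆ Iio b := fun x hx => (ha hx).trans_lt hb
    have hlt : #(Iio b) < #κ.ord.ToType := mk_Iio_lt b (by simp)
    exact ((mk_le_mk_of_subset hsub).trans_lt (hlt.trans_eq (mk_ord_toType κ))).ne hS
  · intro hS
    refine le_antisymm ((mk_set_le S).trans_eq (mk_ord_toType κ)) ?_
    by_contra! hlt
    exact hS (bddAbove_of_mk_lt hreg hlt)

theorem bddAbove_range_Iio {κ : Cardinal.{u}} (hreg : κ.IsRegular) {δ : Ordinal.{u}}
    (hδ : δ < κ.ord) (t : Iio δ → κ.ord.ToType) : BddAbove (range t) := by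
  refine bddAbove_of_mk_lt hreg ?_
  rw [← Ordinal.ToType.mk.symm.surjective.range_comp t]
  exact mk_range_le.trans_lt (by simpa using lt_ord.1 hδ)

/-! ### Weak compactness -/

/-- Choose's victory over the strategy that splits at stage `a` by the colours `f a y` yields, by
Zorn's lemma, an unbounded set on which `f x y` depends only on the smaller point `x`. -/
theorem exists_homogeneous_of_not_cutWinsLT {κ : Cardinal.{u}} (hreg : κ.IsRegular)
    (h : ¬ CutWinsLT univ (bd κ) κ.ord) (f : κ.ord.ToType → κ.ord.ToType → Bool) :
    ∃ (H : Set κ.ord.ToType) (b : Bool), #H = κ ∧ ∀ x ∈ H, ∀ y ∈ H, x < y → f x y = b := by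
  have := noMaxOrder hreg.aleph0_le
  obtain ⟨p, hp, hwin⟩ : ∃ p : Play univ κ.ord,
      p.Follows (splitStrategy univ fun δ => f (Ordinal.ToType.mk δ)) ∧
        ∀ δ : Iio κ.ord, (p.upTo δ).result ∉ bd κ := by
    by_contra! hno
    exact h ⟨splitStrategy univ fun δ => f (Ordinal.ToType.mk δ), fun p hp hw =>
      (hno p hp).elim fun δ hδ => hw δ hδ⟩
  let v : κ.ord.ToType → Bool := fun x => (p (Ordinal.ToType.mk.symm x)).choice
  have hv : ∀ a, ∀ y ∈ (p.upTo (Ordinal.ToType.mk.symm a)).result, ∀ x < a, f x y = v x := by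
    intro a y hy x hx
    have hlt : Ordinal.ToType.mk.symm x < Ordinal.ToType.mk.symm a := by simpa using hx
    have := (hp.mem_picked_split.1 (hy.2 ⟨(Ordinal.ToType.mk.symm x).1, hlt⟩)).2
    exact (congrArg (f · y) ((Ordinal.ToType.mk.apply_symm_apply x).symm)).trans this
  obtain ⟨S, hS⟩ : ∃ S, Maximal
      (fun S : Set κ.ord.ToType => ∀ x ∈ S, ∀ y ∈ S, x < y → f x y = v x) S := by
    refine zorn_subset {S : Set κ.ord.ToType | ∀ x ∈ S, ∀ y ∈ S, x < y → f x y = v x}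
      fun c hc hchain => ⟨⋃₀ c, ?_, fun s => subset_sUnion_of_mem⟩
    rintro x ⟨s, hs, hx⟩ y ⟨t, ht, hy⟩ hxy
    rcases hchain.total hs ht with hst | hts
    · exact hc ht x (hst hx) y hy hxy
    · exact hc hs x hx y (hts hy) hxy
  have hunb : ¬ BddAbove S := by
    rintro ⟨a, ha⟩
    obtain ⟨b, hab⟩ := exists_gt a
    have hD := hwin (Ordinal.ToType.mk.symm b)
    obtain ⟨y, hy, hay⟩ := not_bddAbove_iff.1 hD a
    have hyS : y ∈ S := by
      refine hS.le_of_ge ?_ (subset_insert y S) (mem_insert y S)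
      rintro x (rfl | hx) z (rfl | hz) hxz
      · exact absurd hxz (lt_irrefl _)
      · exact absurd (hxz.trans_le (ha hz)) hay.not_gt
      · exact hv b z hy x ((ha hx).trans_lt hab)
      · exact hS.prop x hx z hz hxz
    exact (ha hyS).not_gt hay
  obtain ⟨b, hb⟩ : ∃ b, ¬ BddAbove {x ∈ S | v x = b} := by
    by_contra! hbdd
    refine hunb (((hbdd false).union (hbdd true)).mono fun x hx => ?_)
    cases hvx : v x
    · exact Or.inl ⟨hx, hvx⟩
    · exact Or.inr ⟨hx, hvx⟩
  exact ⟨_, b, (mk_eq_iff_not_bddAbove hreg).2 hb, fun x hx y hy hxy =>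
    (hS.prop x hx.1 y hy.1 hxy).trans hx.2⟩

open Classical in
/-- Colouring pairs by the first difference of the plays that keep their points makes the choices at
each stage eventually constant along a homogeneous set; the constant values defeat Cut. -/
theorem IsWeaklyCompact.not_cutWinsLT {κ : Cardinal.{u}} (hreg : κ.IsRegular)
    (hκ : IsWeaklyCompact κ) : ¬ CutWinsLT univ (bd κ) κ.ord := by
  rintro ⟨σ, hσ⟩
  choose p hp hmem using fun x : κ.ord.ToType => exists_follows_mem σ (mem_univ x)
  obtain ⟨H, b, hH, hom⟩ := hκ.2 fun x y =>
    if h : {δ | (p x δ).choice ≠ (p y δ).choice}.Nonempty then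
      (p x (wellFounded_lt.min _ h)).choice else true
  rw [mk_eq_iff_not_bddAbove hreg] at hH
  have hfirst : ∀ x ∈ H, ∀ y ∈ H, x < y → ∀ δ, (∀ β < δ, (p x β).choice = (p y β).choice) →
      (p x δ).choice ≠ (p y δ).choice → (p x δ).choice = b := by
    intro x hx y hy hxy δ hagree hne
    have hne' : {δ | (p x δ).choice ≠ (p y δ).choice}.Nonempty := ⟨δ, hne⟩
    have hmin : wellFounded_lt.min _ hne' = δ := by
      refine le_antisymm (wellFounded_lt.min_le hne) (le_of_not_gt fun hlt => ?_)
      exact wellFounded_lt.min_mem _ hne' (hagree _ hlt)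
    have := hom x hx y hy hxy
    rwa [dif_pos hne', hmin] at this
  -- If all earlier choices are constant on `H` above given thresholds, they are so above a common
  -- one, by regularity.
  have hcommon : ∀ (δ : Iio κ.ord) (v : Iio κ.ord → Bool),
      (∀ β < δ, ∃ t, ∀ x ∈ H, t ≤ x → (p x β).choice = v β) →
        ∃ T, ∀ β < δ, ∀ x ∈ H, T ≤ x → (p x β).choice = v β := by
    intro δ v h
    choose t ht using h
    obtain ⟨T, hT⟩ := bddAbove_range_Iio hreg δ.2
      fun β : Iio δ.1 => t (below δ β) (below_lt δ β)
    exact ⟨T, fun β hβ x hx hTx => ht β hβ x hx ((hT ⟨⟨β.1, hβ⟩, rfl⟩).trans hTx)⟩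
  have hconst : ∀ δ, ∃ v t, ∀ x ∈ H, t ≤ x → (p x δ).choice = v := by
    intro δ
    induction δ using WellFoundedLT.induction with
    | ind δ ih =>
      obtain ⟨v, hv⟩ : ∃ v : Iio κ.ord → Bool,
          ∀ β < δ, ∃ t, ∀ x ∈ H, t ≤ x → (p x β).choice = v β := by
        choose! v hv using ih
        exact ⟨v, hv⟩
      obtain ⟨T, hT⟩ := hcommon δ v hv
      by_cases hall : ∀ x ∈ H, T ≤ x → (p x δ).choice = b
      · exact ⟨b, T, hall⟩
      -- A point of `H` above the threshold whose choice at `δ` is not `b` cannot be followed by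
      -- one with a different choice there.
      push Not at hall
      obtain ⟨x, hx, hTx, hxb⟩ := hall
      refine ⟨(p x δ).choice, x, fun y hy hxy => ?_⟩
      rcases hxy.eq_or_lt with rfl | hxy
      · rfl
      by_contra hne
      exact hxb (hfirst x hx y hy hxy δ
        (fun β hβ => (hT β hβ x hx hTx).trans (hT β hβ y hy (hTx.trans hxy.le)).symm)
        (Ne.symm hne))
  choose v hv using hconst
  refine hσ (playAgainst σ fun δ _ => v δ) (follows_playAgainst _ _) fun δ hbdd => hH ?_
  obtain ⟨T, hT⟩ := hcommon δ v fun β _ => hv β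
  obtain ⟨B, hB⟩ := hbdd
  refine ⟨max T B, fun x hx => ?_⟩
  rcases le_total x T with hxT | hTx
  · exact hxT.trans (le_max_left _ _)
  refine (hB ⟨mem_univ x, fun β => ?_⟩).trans (le_max_right _ _)
  have hβ := below_lt δ β
  have heq := (hp x).ext (follows_playAgainst σ fun δ _ => v δ) (below δ β)
    fun ξ hξ => by rw [hT ξ (hξ.trans_lt hβ) x hx hTx, playAgainst_apply]
  have := hmem x (below δ β)
  rwa [heq] at this

end CutChoose

theorem mainTheorem9 (κ : Cardinal.{u}) (hreg : κ.IsRegular) (hunc : Cardinal.aleph0 < κ) :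
    (∀ (γ : Ordinal.{u}), Order.IsSuccLimit γ → γ < κ.ord →
      ∀ (I : Set (Set κ.ord.ToType)), CutChoose.IsMonotoneFamily I →
        CutChoose.NotSmallUnion κ I →
        (CutChoose.CutWins Set.univ I γ → κ ≤ 2 ^ γ.card) ∧
        (CutChoose.CutWinsLE Set.univ I γ → κ ≤ CutChoose.twoPowLT γ) ∧
        ((∀ x : κ.ord.ToType, {x} ∈ I) →
          (CutChoose.CutWins Set.univ I γ ↔ κ ≤ 2 ^ γ.card) ∧
          (CutChoose.CutWinsLE Set.univ I γ ↔ κ ≤ CutChoose.twoPowLT γ)) ∧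
        (CutChoose.twoPowLT γ < κ → ¬ CutChoose.CutWinsLT Set.univ I γ)) ∧
    (CutChoose.CutWinsLT Set.univ (CutChoose.bd κ) κ.ord ↔ ¬ CutChoose.IsWeaklyCompact κ) := by
  refine ⟨fun γ _ hγ I hI hU => ?_, fun h hwc => hwc.not_cutWinsLT hreg h, fun h => ?_⟩
  · have : Nonempty κ.ord.ToType := by
      rw [← mk_ne_zero_iff, mk_ord_toType]
      exact hreg.ne_zero
    have hle : CutChoose.CutWinsLE univ I γ → κ ≤ CutChoose.twoPowLT γ :=
      fun h => h.le_twoPowLT hreg.aleph0_le hγ hU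
    refine ⟨fun h => h.le_two_power hU, hle, fun hsing => ⟨⟨fun h => h.le_two_power hU, fun h => ?_⟩,
      hle, fun h => ?_⟩, fun hlt h => (hle h.cutWinsLE).not_gt hlt⟩
    · exact CutChoose.cutWins_of_le_two_power hI hsing (by simpa using h)
    · obtain ⟨δ, hδ, hκδ⟩ := CutChoose.exists_le_two_power_of_le_twoPowLT hreg hγ h
      exact (CutChoose.cutWinsLT_of_le_two_power hI hsing hδ (by simpa using hκδ)).cutWinsLE
  · by_contra hno
    exact h ⟨hunc, CutChoose.exists_homogeneous_of_not_cutWinsLT hreg hno⟩
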